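/- **Conventions.** A naming space is a set $A^Q$ of functions with $Q$, $A$ countable and non-empty. A represented space $\mathbf X$ is a set $X$ with a naming space $\mathcal B_{\mathbf X}=A_{\mathbf X}^{Q_{\mathbf X}}$ and a surjective partial function $\delta_{\mathbf X}\colon{\subseteq\mathcal B_{\mathbf X}}\to X$; if $\delta_{\mathbf X}(\varphi)=x$, then $\varphi$ is a name of $x$. A partial operator $F\colon{\subseteq A^Q}\to A'^{Q'}$ is continuous if for all $\varphi\in\operatorname{dom}F$ and $q'\in Q'$ there is a finite list $L$ in $Q$ such that $F(\psi)(q')=F(\varphi)(q')$ for all $\psi\in\operatorname{dom}F$ that agree with $\varphi$ on $L$. A function $f\colon\mathbf X\to\mathbf Y$ is realized by $F$ if for each name $\varphi$ of each $x\in X$ the value $F(\varphi)$ is defined and is a name of $f(x)$; $f$ is continuous if it is realized by a continuous partial operator. An isomorphism is a continuous bijection with continuous inverse, and $\mathbf X\simeq\mathbf Y$ means that there is one. The space $\mathbf Y^{\mathbf X}$ consists of the continuous functions $f\colon\mathbf X\to\mathbf Y$; its questions are the pairs $(\mathbf a,q')$ of a finite list $\mathbf a$ in $A_{\mathbf X}$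 and $q'\in Q_{\mathbf Y}$, its answers are the finite lists in $Q_{\mathbf X}$ and the elements of $A_{\mathbf Y}$ (disjoint union), and $\psi$ is a name of $f$ if $F_{U(\psi)}$ realizes $f$. Here $F_{U(\psi)}(\varphi)(q')$ is obtained by evaluating $\psi$ at $(\mathbf a,q')$, starting with the empty list $\mathbf a$: whenever the result is a list $(q_1,\dots,q_k)$ in $Q_{\mathbf X}$, append $\varphi(q_1),\dots,\varphi(q_k)$ to $\mathbf a$ and repeat; when it is an element of $A_{\mathbf Y}$, this is the value. $F_{U(\psi)}(\varphi)$ is defined if this process terminates for every $q'$. $\mathbb N$ is represented with one question $\star$ and $\varphi\in\mathbb N^{\{\star\}}$ naming $\varphi(\star)$. Sierpiński space $\mathbb S=\{\bot,\top\}$ is represented by $\delta_{\mathbb S}\colon\{\mathrm{true},\mathrm{false}\}^{\mathbb N}\to\mathbb S$ with $\delta_{\mathbb S}(\varphi)=\top$ iff $\varphi(n)=\mathrm{true}$ for some $n$. For $U\subseteq\mathbb N$ let $\chi_U\colon\mathbb N\to\mathbb S$ have value $\top$ exactly on $U$. * $\mathcal O(\mathbb N):=\mathbb S^{\mathbb N}$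 (function space), the open subsets of $\mathbb N$ given through their characteristic functions. * $\mathcal A(\mathbb N)$: the subsets $C\subseteq\mathbb N$ with $\chi_{\mathbb N\setminus C}$ continuous; a name of $C$ is an $\mathcal O(\mathbb N)$-name of $\chi_{\mathbb N\setminus C}$. * $\mathcal O_{\mathbb N}$: the subsets of $\mathbb N$, with $\varphi\colon\mathbb N\to\mathbb N$ naming $\{n\mid\exists m\colon\varphi(m)=n+1\}$. * $\mathcal A_{\mathbb N}$: the subsets of $\mathbb N$, with $\varphi\colon\mathbb N\to\mathbb N$ naming $\mathbb N\setminus\{n\mid\exists m\colon\varphi(m)=n+1\}$. **Theorem.** $\mathcal A(\mathbb N)\simeq\mathcal O(\mathbb N)$, $\mathcal A(\mathbb N)\simeq\mathcal A_{\mathbb N}$ and $\mathcal O(\mathbb N)\simeq\mathcal O_{\mathbb N}$. More precisely, the following maps are isomorphisms of represented spaces: 1. complementation $\mathcal A(\mathbb N)\to\mathcal O(\mathbb N)$, $C\mapsto\chi_{\mathbb N\setminus C}$; 2. $\mathcal A(\mathbb N)\to\mathcal A_{\mathbb N}$, $C\mapsto C$; 3. $\mathcal O(\mathbb N)\to\mathcal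 O_{\mathbb N}$, $f\mapsto\{n\mid f(n)=\top\}$. -/

import Mathlib

namespace RepSpaces

/-! ### Multifunctions and operators between naming spaces -/

/-- A multivalued function assigns to each input a possibly empty set of eligible return values. -/
abbrev Multifunction (S T : Type) : Type := S → Set T

/-- The domain of a multifunction. -/
def Multifunction.dom {S T : Type} (F : Multifunction S T) : Set S := {s | (F s).Nonempty}

/-- Two functions coincide on a finite list of arguments. -/
def CoincideOn {Q A : Type} (φ ψ : Q → A) (L : List Q) : Prop := ∀ q ∈ L, φ q = ψ q

/-- The list `L` certifies the value at `q'` of the results of `F` on input `φ`. -/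
def IsCertificate {Q A Q' A' : Type} (F : Multifunction (Q → A) (Q' → A'))
    (φ : Q → A) (q' : Q') (L : List Q) : Prop :=
  ∀ ψ : Q → A, CoincideOn φ ψ L → ∀ φ' ∈ F φ, ∀ ψ' ∈ F ψ, φ' q' = ψ' q'

/-- Continuity of a partial operator, given as a multifunction. A continuous multifunction is
automatically singlevalued (take `ψ = φ` in `IsCertificate`), i.e. is a partial operator. -/
def IsContinuousOperator {Q A Q' A' : Type} (F : Multifunction (Q → A) (Q' → A')) : Prop :=
  ∀ φ ∈ F.dom, ∀ q' : Q', ∃ L : List Q, IsCertificate F φ q' L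

/-- The operator `F_M` specified by a function `M` with an additional effort parameter. -/
def operatorOf {Q A Q' A' : Type} (M : ℕ → (Q → A) → Q' → Option A') :
    Multifunction (Q → A) (Q' → A') :=
  fun φ => {φ' | ∀ q', ∃ n, M n φ q' = some (φ' q')}

/-- At most `n` rounds of evaluating `ψ`, started with the list `l` of answers collected so far:
if `ψ` returns a list of questions, then the answers of `φ` to them are appended to `l` and the
evaluation continues; if `ψ` returns an answer, it is the result. -/
def evalRounds {Q A Q' A' : Type} (ψ : List A × Q' → List Q ⊕ A') (φ : Q → A) (q' : Q') :
    ℕ → List A → Option A'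
  | 0, _ => none
  | n + 1, l =>
    match ψ (l, q') with
    | Sum.inl qs => evalRounds ψ φ q' n (l ++ qs.map φ)
    | Sum.inr a' => some a'

/-- The universal: the evaluation starts with the empty list of answers. -/
def universal {Q A Q' A' : Type} (ψ : List A × Q' → List Q ⊕ A') :
    ℕ → (Q → A) → Q' → Option A' :=
  fun n φ q' => evalRounds ψ φ q' n []

/-! ### Represented spaces -/

/-- A represented space: a set together with a naming space `Q → A` (with `Q` and `A` countable
and non-empty) and a singlevalued, co-total multifunction `δ` from the naming space to the set. -/
structure RepresentedSpace where
  /-- the underlying set -/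
  Carrier : Type
  /-- the questions -/
  Q : Type
  /-- the answers -/
  A : Type
  countable_Q : Countable Q
  nonempty_Q : Nonempty Q
  countable_A : Countable A
  nonempty_A : Nonempty A
  /-- the representation; `x ∈ δ φ` means that `φ` is a name of `x` -/
  δ : Multifunction (Q → A) Carrier
  singlevalued : ∀ φ x y, x ∈ δ φ → y ∈ δ φ → x = y
  cototal : ∀ x, ∃ φ, x ∈ δ φ

/-- `F` realizes `f`: on each name of `x` it is defined and returns a name of `f x`. -/
def IsRealizer (X Y : RepresentedSpace) (F : Multifunction (X.Q → X.A) (Y.Q → Y.A))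
    (f : X.Carrier → Y.Carrier) : Prop :=
  ∀ φ x, x ∈ X.δ φ → φ ∈ F.dom ∧ ∀ φ' ∈ F φ, f x ∈ Y.δ φ'

/-- A function between represented spaces is continuous if it has a continuous realizer. -/
def IsContinuous (X Y : RepresentedSpace) (f : X.Carrier → Y.Carrier) : Prop :=
  ∃ F : Multifunction (X.Q → X.A) (Y.Q → Y.A), IsContinuousOperator F ∧ IsRealizer X Y F f

/-- An isomorphism: a continuous bijection with continuous inverse. -/
def IsIsomorphism (X Y : RepresentedSpace) (f : X.Carrier → Y.Carrier) : Prop :=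
  IsContinuous X Y f ∧ ∃ g : Y.Carrier → X.Carrier,
    Function.LeftInverse g f ∧ Function.RightInverse g f ∧ IsContinuous Y X g

/-! ### The function space -/

theorem evalRounds_unique {Q A Q' A' : Type} (ψ : List A × Q' → List Q ⊕ A') (φ : Q → A)
    (q' : Q') : ∀ (n m : ℕ) (l : List A) (a b : A'),
      evalRounds ψ φ q' n l = some a → evalRounds ψ φ q' m l = some b → a = b := by
  intro n
  induction n with
  | zero => intro m l a b h; simp [evalRounds] at h
  | succ n ih =>
    intro m l a b h h'
    cases m with
    | zero => simp [evalRounds] at h'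
    | succ m =>
      rw [evalRounds] at h h'
      cases hψ : ψ (l, q') with
      | inl qs => rw [hψ] at h h'; exact ih _ _ _ _ h h'
      | inr a' => rw [hψ] at h h'; simp_all

/-- Every continuous operator `F` has an associate: a `ψ` such that the operator coded by `ψ`
tightens `F`. -/
theorem exists_associate {Q A Q' A' : Type} [Countable Q] [Nonempty Q]
    (F : Multifunction (Q → A) (Q' → A')) (hF : IsContinuousOperator F) :
    ∃ ψ : List A × Q' → List Q ⊕ A', ∀ φ ∈ F.dom,
      φ ∈ (operatorOf (universal ψ)).dom ∧ operatorOf (universal ψ) φ ⊆ F φ := by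
  classical
  obtain ⟨e, he⟩ := exists_surjective_nat Q
  let ext : List A → (Q → A) → Prop := fun l φ => (List.range l.length).map (fun i => φ (e i)) = l
  let forced : List A → Q' → A' → Prop := fun l q' a' =>
    ∀ φ, ext l φ → ∀ φ' ∈ F φ, φ' q' = a'
  let ψ : List A × Q' → List Q ⊕ A' := fun p =>
    if h : ∃ a', forced p.1 p.2 a' then Sum.inr h.choose else Sum.inl [e p.1.length]
  let ini : (Q → A) → ℕ → List A := fun φ n => (List.range n).map (fun i => φ (e i))
  have hext : ∀ φ n, ext (ini φ n) φ := by intro φ n; simp [ext, ini]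
  have key : ∀ φ, ∀ φ' ∈ F φ, ∀ q', ∃ n, universal ψ n φ q' = some (φ' q') := by
    intro φ φ' hφ' q'
    obtain ⟨L, hL⟩ := hF φ ⟨φ', hφ'⟩ q'
    have hN : ∃ N, ∀ q ∈ L, ∃ i < N, e i = q := by
      clear hL
      induction L with
      | nil => exact ⟨0, by simp⟩
      | cons q L ih =>
        obtain ⟨N, hN⟩ := ih
        obtain ⟨j, hj⟩ := he q
        refine ⟨max N (j + 1), ?_⟩
        intro r hr
        rcases List.mem_cons.1 hr with rfl | hr
        · exact ⟨j, by omega, hj⟩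
        · obtain ⟨i, hi, h⟩ := hN r hr
          exact ⟨i, by omega, h⟩
    obtain ⟨N, hN⟩ := hN
    have hforced : forced (ini φ N) q' (φ' q') := by
      intro χ hχ χ' hχ'
      refine (hL χ ?_ φ' hφ' χ' hχ').symm
      intro q hq
      obtain ⟨i, hi, rfl⟩ := hN q hq
      simp only [ext, ini, List.length_map, List.length_range] at hχ
      exact (List.map_inj_left.1 hχ i (List.mem_range.2 hi)).symm
    have step : ∀ k n, n + k = N →
        ∃ m, evalRounds ψ φ q' m (ini φ n) = some (φ' q') := by
      intro k
      induction k with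
      | zero =>
        intro n hn
        obtain rfl : n = N := by omega
        have h : ∃ a', forced (ini φ n) q' a' := ⟨_, hforced⟩
        refine ⟨1, ?_⟩
        have : ψ (ini φ n, q') = Sum.inr h.choose := dif_pos h
        rw [evalRounds, this]
        exact congrArg some (h.choose_spec φ (hext φ n) φ' hφ').symm
      | succ k ih =>
        intro n hn
        by_cases h : ∃ a', forced (ini φ n) q' a'
        · refine ⟨1, ?_⟩
          have : ψ (ini φ n, q') = Sum.inr h.choose := dif_pos h
          rw [evalRounds, this]
          exact congrArg some (h.choose_spec φ (hext φ n) φ' hφ').symm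
        · obtain ⟨m, hm⟩ := ih (n + 1) (by omega)
          refine ⟨m + 1, ?_⟩
          have : ψ (ini φ n, q') = Sum.inl [e (ini φ n).length] := dif_neg h
          rw [evalRounds, this]
          simpa [ini, List.range_succ] using hm
    exact step N 0 (by omega)
  refine ⟨ψ, ?_⟩
  rintro φ ⟨φ', hφ'⟩
  refine ⟨⟨φ', key φ φ' hφ'⟩, ?_⟩
  intro χ hχ
  have : χ = φ' := by
    funext q'
    obtain ⟨n, hn⟩ := hχ q'
    obtain ⟨m, hm⟩ := key φ φ' hφ' q'
    exact evalRounds_unique ψ φ q' n m [] _ _ hn hm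
  rwa [this]

/-- The space `Y ^ X` of continuous functions: `ψ` is a name of `f` if the operator that `ψ` codes
through the universal realizes `f`. -/
abbrev functionSpace (X Y : RepresentedSpace) : RepresentedSpace where
  Carrier := {f : X.Carrier → Y.Carrier // IsContinuous X Y f}
  Q := List X.A × Y.Q
  A := List X.Q ⊕ Y.A
  countable_Q := by
    have := X.countable_A; have := Y.countable_Q; infer_instance
  nonempty_Q := by
    have := Y.nonempty_Q; infer_instance
  countable_A := by
    have := X.countable_Q; have := Y.countable_A; infer_instance
  nonempty_A := by
    have := Y.nonempty_A; infer_instance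
  δ := fun ψ => {f | IsRealizer X Y (operatorOf (universal ψ)) f.1}
  singlevalued := by
    intro ψ f g hf hg
    apply Subtype.ext
    funext x
    obtain ⟨φ, hφ⟩ := X.cototal x
    obtain ⟨⟨φ', hφ'⟩, h⟩ := hf φ x hφ
    exact Y.singlevalued φ' _ _ (h φ' hφ') ((hg φ x hφ).2 φ' hφ')
  cototal := by
    rintro ⟨f, F, hF, hr⟩
    have := X.countable_Q
    have := X.nonempty_Q
    obtain ⟨ψ, hψ⟩ := exists_associate F hF
    refine ⟨ψ, ?_⟩
    intro φ x hx
    obtain ⟨hd, hv⟩ := hr φ x hx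
    exact ⟨(hψ φ hd).1, fun φ' hφ' => hv φ' ((hψ φ hd).2 hφ')⟩

/-! ### Natural numbers, Sierpinski space, and hyperspaces -/

/-- The discrete represented space of natural numbers: there is a single question, and a name
answers it with the number. -/
abbrev natSpace : RepresentedSpace where
  Carrier := ℕ
  Q := Unit
  A := ℕ
  countable_Q := inferInstance
  nonempty_Q := inferInstance
  countable_A := inferInstance
  nonempty_A := inferInstance
  δ := fun φ => {φ ()}
  singlevalued := by
    intro φ x y hx hy
    exact (Set.mem_singleton_iff.1 hx).trans (Set.mem_singleton_iff.1 hy).symm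
  cototal := fun n => ⟨fun _ => n, rfl⟩

/-- The points of Sierpinski space. -/
inductive Sierpinski : Type
  | bot : Sierpinski
  | top : Sierpinski

/-- Sierpinski space: a sequence of Booleans is a name of `top` if it takes the value `true`
somewhere, and a name of `bot` otherwise. -/
abbrev sierpinskiSpace : RepresentedSpace where
  Carrier := Sierpinski
  Q := ℕ
  A := Bool
  countable_Q := inferInstance
  nonempty_Q := inferInstance
  countable_A := inferInstance
  nonempty_A := inferInstance
  δ := fun φ => {s | s = Sierpinski.top ↔ ∃ n, φ n = true}
  singlevalued := by
    intro φ x y hx hy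
    have h : x = Sierpinski.top ↔ y = Sierpinski.top := Iff.trans hx (Iff.symm hy)
    cases x <;> cases y <;> simp_all
  cototal := by
    intro s
    cases s with
    | bot => exact ⟨fun _ => false, by simp⟩
    | top => exact ⟨fun _ => true, by simp⟩

open Classical in
/-- The characteristic function of a subset, with values in Sierpinski space. -/
noncomputable def charFun {X : Type} (U : Set X) : X → Sierpinski :=
  fun x => if x ∈ U then Sierpinski.top else Sierpinski.bot

theorem charFun_eq_top {X : Type} (U : Set X) (x : X) :
    charFun U x = Sierpinski.top ↔ x ∈ U := by
  unfold charFun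
  split_ifs with h <;> simp [h]

/-- The space of open subsets of `X`, i.e. the space of continuous functions from `X` to
Sierpinski space (the characteristic functions of the open subsets). -/
abbrev opens (X : RepresentedSpace) : RepresentedSpace := functionSpace X sierpinskiSpace

/-- The space of closed subsets of `X`: the subsets whose complement is open, a name of such a set
being a name of (the characteristic function of) its complement. -/
abbrev closeds (X : RepresentedSpace) : RepresentedSpace where
  Carrier := {C : Set X.Carrier // IsContinuous X sierpinskiSpace (charFun Cᶜ)}
  Q := (opens X).Q
  A := (opens X).A
  countable_Q := (opens X).countable_Q
  nonempty_Q := (opens X).nonempty_Q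
  countable_A := (opens X).countable_A
  nonempty_A := (opens X).nonempty_A
  δ := fun ψ => {C | (⟨charFun C.1ᶜ, C.2⟩ : (opens X).Carrier) ∈ (opens X).δ ψ}
  singlevalued := by
    intro ψ C D hC hD
    have h : charFun C.1ᶜ = charFun D.1ᶜ :=
      congrArg Subtype.val ((opens X).singlevalued ψ _ _ hC hD)
    apply Subtype.ext
    apply compl_injective
    ext x
    rw [← charFun_eq_top, ← charFun_eq_top, h]
  cototal := fun C => (opens X).cototal ⟨charFun C.1ᶜ, C.2⟩

/-- The set enumerated by `φ`; the value `0` of `φ` stands for no element, `n + 1` for `n`. -/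
def enumeratedSet (φ : ℕ → ℕ) : Set ℕ := {n | ∃ m, φ m = n + 1}

theorem exists_enumeration (U : Set ℕ) : ∃ φ, U = enumeratedSet φ := by
  classical
  refine ⟨fun m => if m ∈ U then m + 1 else 0, ?_⟩
  ext n
  constructor
  · intro h
    exact ⟨n, if_pos h⟩
  · rintro ⟨m, hm⟩
    dsimp only at hm
    split_ifs at hm with h
    obtain rfl : m = n := by omega
    exact h

/-- Subsets of the natural numbers, a name of a set being an enumeration of its elements. -/
abbrev enumOpens : RepresentedSpace where
  Carrier := Set ℕ
  Q := ℕ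
  A := ℕ
  countable_Q := inferInstance
  nonempty_Q := inferInstance
  countable_A := inferInstance
  nonempty_A := inferInstance
  δ := fun φ => {enumeratedSet φ}
  singlevalued := by
    intro φ x y hx hy
    exact (Set.mem_singleton_iff.1 hx).trans (Set.mem_singleton_iff.1 hy).symm
  cototal := fun U => exists_enumeration U

/-- Subsets of the natural numbers, a name of a set being an enumeration of its complement. -/
abbrev enumCloseds : RepresentedSpace where
  Carrier := Set ℕ
  Q := ℕ
  A := ℕ
  countable_Q := inferInstance
  nonempty_Q := inferInstance
  countable_A := inferInstance
  nonempty_A := inferInstance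
  δ := fun φ => {(enumeratedSet φ)ᶜ}
  singlevalued := by
    intro φ x y hx hy
    exact (Set.mem_singleton_iff.1 hx).trans (Set.mem_singleton_iff.1 hy).symm
  cototal := by
    intro C
    obtain ⟨φ, hφ⟩ := exists_enumeration Cᶜ
    exact ⟨φ, by rw [Set.mem_singleton_iff, ← hφ, compl_compl]⟩

end RepSpaces

/-!
A name of an open set `U ⊆ ℕ` is a procedure which, given `n`, semidecides `n ∈ U`. Running it on
all `n` in parallel, for all questions and all numbers of rounds, enumerates `U`; conversely, an
enumeration of `U` semidecides `n ∈ U` by waiting for `n` to appear. Each output value of either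
translation of names inspects only finitely many input values. Complementation does not change
names at all, so the statement for closed sets follows by composing isomorphisms.
-/

namespace RepSpaces

section Finitary

variable {Q A B C : Type}

/-- A functional on a naming space is finitary if each of its values is determined by finitely many
values of the argument, i.e. if it is continuous for the product topology on `Q → A` with `A` and
`B` discrete. A map between naming spaces is handled through its coordinate functionals. -/
def IsFinitary (G : (Q → A) → B) : Prop := ∀ φ, ∃ L, ∀ ψ, CoincideOn φ ψ L → G φ = G ψ

theorem isFinitary_const (b : B) : IsFinitary fun _ : Q → A => b :=
  fun _ => ⟨[], fun _ _ => rfl⟩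

theorem isFinitary_apply (q : Q) : IsFinitary fun φ : Q → A => φ q :=
  fun _ => ⟨[q], fun _ h => h q List.mem_cons_self⟩

theorem IsFinitary.bind {G : (Q → A) → B} {K : B → (Q → A) → C} (hG : IsFinitary G)
    (hK : ∀ b, IsFinitary (K b)) : IsFinitary fun φ => K (G φ) φ := by
  intro φ
  obtain ⟨L, hL⟩ := hG φ
  obtain ⟨M, hM⟩ := hK (G φ) φ
  refine ⟨L ++ M, fun ψ h => ?_⟩
  have hGψ : G φ = G ψ := hL ψ fun q hq => h q (List.mem_append_left M hq)
  have hKψ : K (G φ) φ = K (G φ) ψ := hM ψ fun q hq => h q (List.mem_append_right L hq)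
  exact hKψ.trans (by rw [hGψ])

theorem IsFinitary.map {G : (Q → A) → B} (hG : IsFinitary G) (h : B → C) :
    IsFinitary fun φ => h (G φ) :=
  hG.bind fun b => isFinitary_const (h b)

end Finitary

section Universal

variable {Q A Q' A' : Type}

theorem isFinitary_evalRounds (φ : Q → A) (q' : Q') (n : ℕ) (l : List A) :
    IsFinitary fun ψ : List A × Q' → List Q ⊕ A' => evalRounds ψ φ q' n l := by
  induction n generalizing l with
  | zero => exact isFinitary_const none
  | succ n ih =>
    refine (isFinitary_apply (l, q')).bind (K := fun (r : List Q ⊕ A') ψ =>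
      match r with
      | Sum.inl qs => evalRounds ψ φ q' n (l ++ qs.map φ)
      | Sum.inr a' => some a') ?_
    rintro (qs | a')
    · exact ih (l ++ qs.map φ)
    · exact isFinitary_const (some a')

theorem exists_universal_eq_some_iff {ψ : List A × Q' → List Q ⊕ A'} {φ : Q → A} {φ' : Q' → A'}
    (h : φ' ∈ operatorOf (universal ψ) φ) (q' : Q') (a' : A') :
    (∃ n, universal ψ n φ q' = some a') ↔ φ' q' = a' := by
  obtain ⟨n, hn⟩ := h q'
  exact ⟨fun ⟨m, hm⟩ => evalRounds_unique ψ φ q' n m [] _ _ hn hm, fun h' => ⟨n, h' ▸ hn⟩⟩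

theorem operatorOf_universal_eq_singleton {ψ : List A × Q' → List Q ⊕ A'} {φ : Q → A}
    {φ' : Q' → A'} (h : φ' ∈ operatorOf (universal ψ) φ) :
    operatorOf (universal ψ) φ = {φ'} :=
  Set.eq_singleton_iff_unique_mem.2
    ⟨h, fun _ hχ => funext fun q' => ((exists_universal_eq_some_iff h q' _).1 (hχ q')).symm⟩

end Universal

section Composition

/-- The relational composition of multifunctions: some value of `F` at `s` is passed on to `G`. On a
singlevalued `F` this is the composition of partial functions. -/
def Multifunction.comp {S T U : Type} (G : Multifunction T U) (F : Multifunction S T) :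
    Multifunction S U :=
  fun s => {u | ∃ t ∈ F s, u ∈ G t}

variable {Q A Q' A' Q'' A'' : Type}

theorem IsContinuousOperator.exists_list_coincideOn {F : Multifunction (Q → A) (Q' → A')}
    (hF : IsContinuousOperator F) {φ : Q → A} {φ' : Q' → A'} (hφ' : φ' ∈ F φ) (L' : List Q') :
    ∃ L, ∀ ψ, CoincideOn φ ψ L → ∀ ψ' ∈ F ψ, CoincideOn φ' ψ' L' := by
  choose L hL using hF φ ⟨φ', hφ'⟩
  refine ⟨L'.flatMap L, fun ψ hψ ψ' hψ' q' hq' => hL q' ψ (fun q hq => ?_) φ' hφ' ψ' hψ'⟩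
  exact hψ q (List.mem_flatMap.2 ⟨q', hq', hq⟩)

theorem IsContinuousOperator.comp {G : Multifunction (Q' → A') (Q'' → A'')}
    {F : Multifunction (Q → A) (Q' → A')} (hG : IsContinuousOperator G)
    (hF : IsContinuousOperator F) : IsContinuousOperator (G.comp F) := by
  rintro φ ⟨φ'', φ', hφ', hφ''⟩ q''
  obtain ⟨L', hL'⟩ := hG φ' ⟨φ'', hφ''⟩ q''
  obtain ⟨L, hL⟩ := hF.exists_list_coincideOn hφ' L'
  have value_eq : ∀ ψ, CoincideOn φ ψ L → ∀ ψ'' ∈ G.comp F ψ, φ'' q'' = ψ'' q'' := by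
    rintro ψ hψ ψ'' ⟨ψ', hψ', hψ''⟩
    exact hL' ψ' (hL ψ hψ ψ' hψ') φ'' hφ'' ψ'' hψ''
  exact ⟨L, fun ψ hψ χ hχ ψ'' hψ'' =>
    (value_eq φ (fun _ _ => rfl) χ hχ).symm.trans (value_eq ψ hψ ψ'' hψ'')⟩

variable {X Y Z : RepresentedSpace}

theorem IsRealizer.comp {G : Multifunction (Y.Q → Y.A) (Z.Q → Z.A)}
    {F : Multifunction (X.Q → X.A) (Y.Q → Y.A)} {g : Y.Carrier → Z.Carrier}
    {f : X.Carrier → Y.Carrier} (hG : IsRealizer Y Z G g) (hF : IsRealizer X Y F f) :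
    IsRealizer X Z (G.comp F) (g ∘ f) := by
  intro φ x hx
  obtain ⟨⟨φ', hφ'⟩, hname⟩ := hF φ x hx
  obtain ⟨φ'', hφ''⟩ := (hG φ' (f x) (hname φ' hφ')).1
  refine ⟨⟨φ'', φ', hφ', hφ''⟩, ?_⟩
  rintro χ'' ⟨χ', hχ', hχ''⟩
  exact (hG χ' (f x) (hname χ' hχ')).2 χ'' hχ''

theorem IsContinuous.comp {g : Y.Carrier → Z.Carrier} {f : X.Carrier → Y.Carrier}
    (hg : IsContinuous Y Z g) (hf : IsContinuous X Y f) : IsContinuous X Z (g ∘ f) :=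
  let ⟨G, hG, hGg⟩ := hg
  let ⟨F, hF, hFf⟩ := hf
  ⟨G.comp F, hG.comp hF, hGg.comp hFf⟩

theorem IsIsomorphism.comp {g : Y.Carrier → Z.Carrier} {f : X.Carrier → Y.Carrier}
    (hg : IsIsomorphism Y Z g) (hf : IsIsomorphism X Y f) : IsIsomorphism X Z (g ∘ f) :=
  let ⟨hg_cont, g', hg_left, hg_right, hg'_cont⟩ := hg
  let ⟨hf_cont, f', hf_left, hf_right, hf'_cont⟩ := hf
  ⟨hg_cont.comp hf_cont, f' ∘ g', hg_left.comp hf_left, hg_right.comp hf_right,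
    hf'_cont.comp hg'_cont⟩

end Composition

theorem isContinuous_of_isFinitary {X Y : RepresentedSpace} {f : X.Carrier → Y.Carrier}
    (G : (X.Q → X.A) → Y.Q → Y.A) (hG : ∀ q', IsFinitary fun φ => G φ q')
    (hf : ∀ φ x, x ∈ X.δ φ → f x ∈ Y.δ (G φ)) : IsContinuous X Y f := by
  refine ⟨fun φ => {G φ}, fun φ _ q' => ?_, fun φ x hx => ⟨⟨G φ, rfl⟩, ?_⟩⟩
  · obtain ⟨L, hL⟩ := hG q' φ
    refine ⟨L, ?_⟩
    rintro ψ hψ _ rfl _ rfl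
    exact hL ψ hψ
  · rintro _ rfl
    exact hf φ x hx

section Complementation

theorem setOf_charFun_eq_top {X : Type} (U : Set X) : {x | charFun U x = Sierpinski.top} = U :=
  Set.ext (charFun_eq_top U)

theorem Sierpinski.eq_of_eq_top_iff {s t : Sierpinski} (h : s = top ↔ t = top) : s = t := by
  cases s <;> cases t <;> simp_all

theorem charFun_setOf_eq_top {X : Type} (f : X → Sierpinski) :
    charFun {x | f x = Sierpinski.top} = f :=
  funext fun x => Sierpinski.eq_of_eq_top_iff (charFun_eq_top _ x)

theorem compl_setOf_charFun_compl_eq_top {X : Type} (C : Set X) :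
    {x | charFun Cᶜ x = Sierpinski.top}ᶜ = C := by
  rw [setOf_charFun_eq_top, compl_compl]

theorem charFun_compl_compl_setOf_eq_top {X : Type} (f : X → Sierpinski) :
    charFun ({x | f x = Sierpinski.top}ᶜ)ᶜ = f := by
  rw [compl_compl, charFun_setOf_eq_top]

/-- Complementation as a map from the closed to the open subsets of `X`, the latter given by their
characteristic functions. -/
noncomputable def closedsCompl (X : RepresentedSpace) (C : (closeds X).Carrier) :
    (opens X).Carrier :=
  ⟨charFun C.1ᶜ, C.2⟩

theorem isIsomorphism_closedsCompl (X : RepresentedSpace) :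
    IsIsomorphism (closeds X) (opens X) (closedsCompl X) := by
  let opensCompl (U : (opens X).Carrier) : (closeds X).Carrier :=
    ⟨{x | U.1 x = Sierpinski.top}ᶜ, (charFun_compl_compl_setOf_eq_top U.1).symm ▸ U.2⟩
  have compl_opensCompl : Function.RightInverse opensCompl (closedsCompl X) :=
    fun U => Subtype.ext (charFun_compl_compl_setOf_eq_top U.1)
  refine ⟨isContinuous_of_isFinitary id isFinitary_apply fun _ _ hC => hC,
    opensCompl, fun C => Subtype.ext (compl_setOf_charFun_compl_eq_top C.1), compl_opensCompl,
    isContinuous_of_isFinitary id isFinitary_apply fun ψ U hU => ?_⟩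
  change closedsCompl X (opensCompl U) ∈ (opens X).δ ψ
  rwa [compl_opensCompl U]

theorem isIsomorphism_compl_enumOpens_enumCloseds :
    IsIsomorphism enumOpens enumCloseds (compl : Set ℕ → Set ℕ) := by
  refine ⟨isContinuous_of_isFinitary (X := enumOpens) (Y := enumCloseds) id isFinitary_apply ?_,
    (compl : Set ℕ → Set ℕ), compl_compl, compl_compl,
    isContinuous_of_isFinitary (X := enumCloseds) (Y := enumOpens) id isFinitary_apply ?_⟩
  · exact fun _ _ hU => congrArg compl hU
  · exact fun _ _ hC => compl_eq_comm.1 hC.symm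

end Complementation

section NatDomain

/-- The procedure for computing a function on `natSpace` whose value at `n` has the name `G n`: ask
for `n`, and then answer according to `G n`. -/
def natAssociate {Q' A' : Type} (G : ℕ → Q' → A') : List ℕ × Q' → List Unit ⊕ A'
  | ([], _) => Sum.inl [()]
  | (n :: _, q') => Sum.inr (G n q')

theorem operatorOf_universal_natAssociate {Q' A' : Type} (G : ℕ → Q' → A') (φ : Unit → ℕ) :
    operatorOf (universal (natAssociate G)) φ = {G (φ ())} :=
  operatorOf_universal_eq_singleton fun _ => ⟨2, rfl⟩

theorem isFinitary_natAssociate {Q A Q' A' : Type} {G : (Q → A) → ℕ → Q' → A'}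
    (hG : ∀ n q', IsFinitary fun φ => G φ n q') (p : List ℕ × Q') :
    IsFinitary fun φ => natAssociate (G φ) p :=
  match p with
  | ([], _) => isFinitary_const (Sum.inl [()])
  | (n :: _, q') => (hG n q').map Sum.inr

variable {Y : RepresentedSpace}

theorem isRealizer_natAssociate {f : ℕ → Y.Carrier} {G : ℕ → Y.Q → Y.A}
    (hG : ∀ n, f n ∈ Y.δ (G n)) :
    IsRealizer natSpace Y (operatorOf (universal (natAssociate G))) f := by
  rintro φ _ rfl
  rw [Multifunction.dom, Set.mem_ofPred_eq, operatorOf_universal_natAssociate]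
  refine ⟨Set.singleton_nonempty _, ?_⟩
  rintro _ rfl
  exact hG (φ ())

theorem isContinuous_of_natSpace (f : ℕ → Y.Carrier) : IsContinuous natSpace Y f := by
  choose name hname using fun n => Y.cototal (f n)
  refine isContinuous_of_isFinitary (X := natSpace) (fun φ => name (φ ()))
    (fun q' => (isFinitary_apply ()).map fun n => name n q') ?_
  rintro φ _ rfl
  exact hname (φ ())

end NatDomain

section Enumeration

/-- An enumeration of the numbers `n` for which the search for some `k` with `p n k` succeeds: the
argument encodes the pair of `n` and `k`. -/
def searchEnumeration (p : ℕ → ℕ → Bool) (m : ℕ) : ℕ :=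
  bif p m.unpair.1 m.unpair.2 then m.unpair.1 + 1 else 0

theorem enumeratedSet_searchEnumeration (p : ℕ → ℕ → Bool) :
    enumeratedSet (searchEnumeration p) = {n | ∃ k, p n k = true} := by
  ext n
  constructor
  · rintro ⟨m, hm⟩
    cases hp : p m.unpair.1 m.unpair.2 with
    | false => simp [searchEnumeration, hp] at hm
    | true =>
      obtain rfl : m.unpair.1 = n := by simpa [searchEnumeration, hp] using hm
      exact ⟨m.unpair.2, hp⟩
  · rintro ⟨k, hk⟩
    exact ⟨Nat.pair n k, by simp [searchEnumeration, hk]⟩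

/-- The translation of names of open subsets of `ℕ` into enumerations. The search for evidence that
`n` belongs to the set ranges over pairs of a question to the Sierpinski name computed from `n` and
a number of rounds for which to evaluate it. -/
def enumerationOfName (ψ : List ℕ × ℕ → List Unit ⊕ Bool) : ℕ → ℕ :=
  searchEnumeration fun n k => universal ψ k.unpair.2 (fun _ => n) k.unpair.1 == some true

theorem isFinitary_enumerationOfName (m : ℕ) : IsFinitary fun ψ => enumerationOfName ψ m :=
  (isFinitary_evalRounds _ _ _ []).map fun r => bif r == some true then m.unpair.1 + 1 else 0

theorem enumeratedSet_enumerationOfName {ψ : List ℕ × ℕ → List Unit ⊕ Bool} {f : ℕ → Sierpinski}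
    (hψ : IsRealizer natSpace sierpinskiSpace (operatorOf (universal ψ)) f) :
    enumeratedSet (enumerationOfName ψ) = {n | f n = Sierpinski.top} := by
  rw [enumerationOfName, enumeratedSet_searchEnumeration]
  ext n
  obtain ⟨⟨φ', hφ'⟩, hname⟩ := hψ (fun _ => n) n rfl
  calc (∃ k : ℕ, (universal ψ k.unpair.2 (fun _ => n) k.unpair.1 == some true) = true)
      ↔ ∃ q r, universal ψ r (fun _ => n) q = some true := by
        simp only [beq_iff_eq]
        exact (Nat.surjective_unpair.exists
          (p := fun qr => universal ψ qr.2 (fun _ => n) qr.1 = some true)).symm.trans Prod.exists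
    _ ↔ ∃ q, φ' q = true := exists_congr fun q => exists_universal_eq_some_iff hφ' q true
    _ ↔ f n = Sierpinski.top := (hname φ' hφ').symm

/-- The translation of enumerations into names of open subsets of `ℕ`: the `m`-th entry of the
Sierpinski name computed from `n` tells whether `φ m` stands for `n`. -/
def nameOfEnumeration (φ : ℕ → ℕ) : List ℕ × ℕ → List Unit ⊕ Bool :=
  natAssociate fun n m => φ m == n + 1

theorem isFinitary_nameOfEnumeration (p : List ℕ × ℕ) : IsFinitary fun φ => nameOfEnumeration φ p :=
  isFinitary_natAssociate (fun n m => (isFinitary_apply m).map (· == n + 1)) p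

theorem isRealizer_nameOfEnumeration (φ : ℕ → ℕ) :
    IsRealizer natSpace sierpinskiSpace (operatorOf (universal (nameOfEnumeration φ)))
      (charFun (enumeratedSet φ)) :=
  isRealizer_natAssociate (Y := sierpinskiSpace) fun n =>
    (charFun_eq_top _ n).trans <| exists_congr fun _ => beq_iff_eq.symm

theorem isIsomorphism_opens_enumOpens :
    IsIsomorphism (opens natSpace) enumOpens fun U => {n : ℕ | U.1 n = Sierpinski.top} := by
  refine ⟨isContinuous_of_isFinitary (X := opens natSpace) (Y := enumOpens)
      enumerationOfName isFinitary_enumerationOfName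
      fun _ _ hU => (enumeratedSet_enumerationOfName hU).symm,
    fun U => ⟨charFun U, isContinuous_of_natSpace (Y := sierpinskiSpace) (charFun U)⟩,
    fun U => Subtype.ext (charFun_setOf_eq_top U.1), setOf_charFun_eq_top,
    isContinuous_of_isFinitary (X := enumOpens) (Y := opens natSpace)
      nameOfEnumeration isFinitary_nameOfEnumeration ?_⟩
  rintro φ _ rfl
  exact isRealizer_nameOfEnumeration φ

end Enumeration

end RepSpaces

theorem mainTheorem2 :
    (∃ f : (RepSpaces.closeds RepSpaces.natSpace).Carrier →
          (RepSpaces.opens RepSpaces.natSpace).Carrier,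
      RepSpaces.IsIsomorphism (RepSpaces.closeds RepSpaces.natSpace)
        (RepSpaces.opens RepSpaces.natSpace) f ∧
      ∀ C, (f C).1 = RepSpaces.charFun C.1ᶜ) ∧
    (∃ f : (RepSpaces.closeds RepSpaces.natSpace).Carrier → RepSpaces.enumCloseds.Carrier,
      RepSpaces.IsIsomorphism (RepSpaces.closeds RepSpaces.natSpace) RepSpaces.enumCloseds f ∧
      ∀ C, f C = C.1) ∧
    (∃ f : (RepSpaces.opens RepSpaces.natSpace).Carrier → RepSpaces.enumOpens.Carrier,
      RepSpaces.IsIsomorphism (RepSpaces.opens RepSpaces.natSpace) RepSpaces.enumOpens f ∧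
      ∀ U, f U = {n : ℕ | U.1 n = RepSpaces.Sierpinski.top}) :=
  open RepSpaces in
  ⟨⟨_, isIsomorphism_closedsCompl natSpace, fun _ => rfl⟩,
    ⟨_, isIsomorphism_compl_enumOpens_enumCloseds.comp
      (isIsomorphism_opens_enumOpens.comp (isIsomorphism_closedsCompl natSpace)),
      fun C => compl_setOf_charFun_compl_eq_top C.1⟩,
    ⟨_, isIsomorphism_opens_enumOpens, fun _ => rfl⟩⟩
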